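/- Let $K$ be a field, $\varphi$ a ring endomorphism of $K$, and let $R=K[t;\varphi]$ be the ring of twisted polynomials $\sum_i t^i a_i$ ($a_i\in K$, almost all zero) with the multiplication determined by $a\,t=t\,\varphi(a)$ for $a\in K$. Consider right $R$-modules as structures in the first-order language $\{0,+,-\}\cup\{\,\cdot r : r\in R\}$. A right $R$-module $M$ is divisible if $M\cdot r=M$ for every nonzero $r\in R$. Let $T_d^{*}$ be the theory of nonzero divisible right $R$-modules, i.e. the axioms of right $R$-modules, the axioms $\forall x\,\exists y\; y\cdot r=x$ for $r\in R\setminus\{0\}$, and $\exists x\; x\neq 0$. For a function $\nu$ from the set of irreducible elements of $R$ to $\mathbb{N}\cup\{\infty\}$, let $C_\nu$ be the set of sentences saying that for every irreducible $q\in R$ the number of elements $x$ with $x\cdot q=0$ is $\nu(q)$, where all infinite cardinalities are written $\infty$ (for each natural number $n$ it contains "there are at least $n$ such elements" if $n\le\nu(q)$, and the negation of this sentence otherwise). (1) Every complete theory $T$ with $T\vdash T_d^{*}$ eliminates quantifiers: every formula is equivalent modulo $T$ to a quantifier-free formula in the same variables. Moreover, there is exactly one function $\nu$ such that $T$ and $T_d^{*}\cup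 C_\nu$ have the same consequences. (2) For every function $\nu$ for which $T_d^{*}\cup C_\nu$ is consistent, the theory $T_d^{*}\cup C_\nu$ is complete. -/

import Mathlib

open FirstOrder FirstOrder.Language
open scoped FirstOrder MulOpposite

universe u v

/-- Multiplication of `φ`-twisted polynomials, on finitely supported coefficient sequences: the
biadditive map with `(tᵏ a) (tˡ b) = tᵏ⁺ˡ φˡ(a) b`. -/
noncomputable def twistedMul {K : Type u} [Field K] (φ : K →+* K) (p q : ℕ →₀ K) : ℕ →₀ K :=
  p.sum fun k a => q.sum fun l b => Finsupp.single (k + l) (φ^[l] a * b)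

namespace twistedMul

variable {K : Type u} [Field K] {φ : K →+* K}

theorem zero_mul (p : ℕ →₀ K) : twistedMul φ 0 p = 0 := Finsupp.sum_zero_index

theorem mul_zero (p : ℕ →₀ K) : twistedMul φ p 0 = 0 := by
  simp [twistedMul]

theorem mul_add (p q r : ℕ →₀ K) :
    twistedMul φ p (q + r) = twistedMul φ p q + twistedMul φ p r := by
  unfold twistedMul
  rw [← Finsupp.sum_add]
  refine Finsupp.sum_congr fun k _ => ?_
  exact Finsupp.sum_add_index' (by simp) (by simp [_root_.mul_add])

theorem add_mul (p q r : ℕ →₀ K) :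
    twistedMul φ (p + q) r = twistedMul φ p r + twistedMul φ q r := by
  unfold twistedMul
  refine Finsupp.sum_add_index' (fun k => ?_) (fun k a b => ?_)
  · simp
  · rw [← Finsupp.sum_add]
    refine Finsupp.sum_congr fun l _ => ?_
    rw [iterate_map_add, _root_.add_mul, Finsupp.single_add]

theorem single_mul_single (k l : ℕ) (a b : K) :
    twistedMul φ (Finsupp.single k a) (Finsupp.single l b) =
      Finsupp.single (k + l) (φ^[l] a * b) := by
  simp [twistedMul]

theorem mul_assoc (p q r : ℕ →₀ K) :
    twistedMul φ (twistedMul φ p q) r = twistedMul φ p (twistedMul φ q r) := by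
  induction p using Finsupp.induction_linear with
  | zero => simp only [zero_mul]
  | add p p' hp hp' => simp only [add_mul, hp, hp']
  | single i a =>
    induction q using Finsupp.induction_linear with
    | zero => simp only [zero_mul, mul_zero]
    | add q q' hq hq' => simp only [add_mul, mul_add, hq, hq']
    | single j b =>
      induction r using Finsupp.induction_linear with
      | zero => simp only [mul_zero]
      | add r r' hr hr' => simp only [mul_add, hr, hr']
      | single k c =>
        simp only [single_mul_single, iterate_map_mul, _root_.mul_assoc, add_assoc]
        rw [add_comm j k, Function.iterate_add_apply]

theorem one_mul (p : ℕ →₀ K) : twistedMul φ (Finsupp.single 0 1) p = p := by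
  induction p using Finsupp.induction_linear with
  | zero => simp only [mul_zero]
  | add p q hp hq => simp only [mul_add, hp, hq]
  | single i a => rw [single_mul_single, iterate_map_one, _root_.one_mul, zero_add]

theorem mul_one (p : ℕ →₀ K) : twistedMul φ p (Finsupp.single 0 1) = p := by
  induction p using Finsupp.induction_linear with
  | zero => simp only [zero_mul]
  | add p q hp hq => simp only [add_mul, hp, hq]
  | single i a => simp [single_mul_single]

/-- The coefficients of a product: `cᵢ = ∑_{k+l=i} φˡ(aₖ) bₗ`. -/
theorem coeff (p q : ℕ →₀ K) (i : ℕ) :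
    twistedMul φ p q i =
      ∑ x ∈ Finset.HasAntidiagonal.antidiagonal i, φ^[x.2] (p x.1) * q x.2 := by
  induction p using Finsupp.induction_linear with
  | zero => simp [zero_mul]
  | add p p' hp hp' =>
    simp [add_mul, hp, hp', iterate_map_add, _root_.add_mul, Finset.sum_add_distrib]
  | single k a =>
    induction q using Finsupp.induction_linear with
    | zero => simp [mul_zero]
    | add q q' hq hq' => simp [mul_add, hq, hq', _root_.mul_add, Finset.sum_add_distrib]
    | single l b =>
      rw [single_mul_single, Finsupp.single_apply]
      by_cases h : k + l = i
      · rw [if_pos h, Finset.sum_eq_single (k, l)]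
        · simp
        · rintro ⟨x, y⟩ - hne
          by_cases hx : k = x
          · by_cases hy : l = y
            · simp [hx, hy] at hne
            · simp [Finsupp.single_apply, hy]
          · simp [Finsupp.single_apply, hx]
        · simp [h]
      · rw [if_neg h, Finset.sum_eq_zero]
        rintro ⟨x, y⟩ hxy
        rw [Finset.HasAntidiagonal.mem_antidiagonal] at hxy
        by_cases hx : k = x
        · by_cases hy : l = y
          · exact absurd (by rw [hx, hy]; exact hxy) h
          · simp [Finsupp.single_apply, hy]
        · simp [Finsupp.single_apply, hx]

end twistedMul

/-- The ring `K[t;φ]` of `φ`-twisted polynomials over a field `K`, for a ring endomorphism `φ`: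
formal sums `∑ tⁱ aᵢ` with finitely many nonzero coefficients `aᵢ ∈ K` (written on the right of
the powers of `t`), where the multiplication obeys `a t = t φ(a)`. -/
def TwistedPoly {K : Type u} [Field K] (_φ : K →+* K) : Type u := ℕ →₀ K

noncomputable instance {K : Type u} [Field K] (φ : K →+* K) : Ring (TwistedPoly φ) :=
  { (inferInstance : AddCommGroup (ℕ →₀ K)) with
    mul := twistedMul φ
    one := (Finsupp.single 0 1 : ℕ →₀ K)
    left_distrib := twistedMul.mul_add
    right_distrib := twistedMul.add_mul
    zero_mul := twistedMul.zero_mul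
    mul_zero := twistedMul.mul_zero
    mul_assoc := twistedMul.mul_assoc
    one_mul := twistedMul.one_mul
    mul_one := twistedMul.mul_one }

/-- The function symbols `0`, `+`, `-` and `·s` for `s ∈ S` of the language of right
`S`-modules. -/
inductive ModFunc (S : Type u) : ℕ → Type u
  | zero : ModFunc S 0
  | add : ModFunc S 2
  | neg : ModFunc S 1
  | smul (s : S) : ModFunc S 1

/-- The first-order language `{0, +, -} ∪ {·s | s ∈ S}` of right `S`-modules. -/
def modLang (S : Type u) : FirstOrder.Language.{u, 0} where
  Functions := ModFunc S
  Relations := fun _ => Empty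

namespace modLang

variable {S : Type u} {α : Type*}

/-- The term `0`. -/
def zero : (modLang S).Term α := Constants.term (L := modLang S) ModFunc.zero

/-- The term `x + y`. -/
def add (x y : (modLang S).Term α) : (modLang S).Term α :=
  Functions.apply₂ (L := modLang S) ModFunc.add x y

/-- The term `-x`. -/
def neg (x : (modLang S).Term α) : (modLang S).Term α :=
  Functions.apply₁ (L := modLang S) ModFunc.neg x

/-- The term `x.s`. -/
def smul (x : (modLang S).Term α) (s : S) : (modLang S).Term α :=
  Functions.apply₁ (L := modLang S) (ModFunc.smul s) x

/-- The sentence "there are at least `n` distinct elements `x` with `x.q = 0`". -/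
noncomputable def atLeastRoots (q : S) (n : ℕ) : (modLang S).Sentence :=
  ((BoundedFormula.iInf fun i : Fin n =>
      (smul (&i) q =' zero : (modLang S).BoundedFormula Empty n)) ⊓
    BoundedFormula.iInf fun p : {p : Fin n × Fin n // p.1 ≠ p.2} =>
      ∼((&p.1.1 : (modLang S).Term (Empty ⊕ Fin n)) =' &p.1.2)).exs

variable (S) [Ring S]

/-- The axioms of right `S`-modules. -/
inductive IsModuleAxiom : (modLang S).Sentence → Prop
  | add_assoc : IsModuleAxiom (∀' ∀' ∀' (add (add (&0) (&1)) (&2) =' add (&0) (add (&1) (&2))))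
  | add_comm : IsModuleAxiom (∀' ∀' (add (&0) (&1) =' add (&1) (&0)))
  | add_zero : IsModuleAxiom (∀' (add (&0) zero =' &0))
  | add_neg : IsModuleAxiom (∀' (add (&0) (neg (&0)) =' zero))
  | smul_one : IsModuleAxiom (∀' (smul (&0) 1 =' &0))
  | smul_mul (r s : S) : IsModuleAxiom (∀' (smul (&0) (r * s) =' smul (smul (&0) r) s))
  | smul_add (r s : S) : IsModuleAxiom (∀' (smul (&0) (r + s) =' add (smul (&0) r) (smul (&0) s)))
  | add_smul (r : S) :
      IsModuleAxiom (∀' ∀' (smul (add (&0) (&1)) r =' add (smul (&0) r) (smul (&1) r)))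

/-- The sentence "every element is of the form `y.r`". -/
def divisibleBy {S : Type u} (r : S) : (modLang S).Sentence := ∀' ∃' (smul (&1) r =' &0)

/-- The sentence "there is a nonzero element". -/
def nonzero : (modLang S).Sentence := ∃' ∼(&0 =' zero)

/-- The theory of nonzero divisible right `S`-modules (for a domain `S`): the module axioms,
divisibility by every `r ≠ 0`, and `∃ x, x ≠ 0`. -/
def divisibleTheory : (modLang S).Theory :=
  {σ | IsModuleAxiom S σ} ∪ {σ | ∃ r : S, r ≠ 0 ∧ σ = divisibleBy r} ∪ {nonzero S}

/-- The set of sentences saying that, for every irreducible `q`, the number of elements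
annihilated by `q` is `ν q`, a natural number or `∞`. -/
def rootCountTheory (ν : {q : S // Irreducible q} → ℕ∞) : (modLang S).Theory :=
  {σ | ∃ q, ∃ n : ℕ, (n : ℕ∞) ≤ ν q ∧ σ = atLeastRoots q.1 n} ∪
    {σ | ∃ q, ∃ n : ℕ, ν q < (n : ℕ∞) ∧ σ = (atLeastRoots q.1 n).not}

variable {S}

/-- A right `S`-module is a structure for the language of right `S`-modules. Right modules are
modules over the opposite ring. -/
instance (M : Type v) [AddCommGroup M] [Module Sᵐᵒᵖ M] : (modLang S).Structure M where
  funMap := fun {_} f x => match f, x with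
    | ModFunc.zero, _ => 0
    | ModFunc.add, x => x 0 + x 1
    | ModFunc.neg, x => -x 0
    | ModFunc.smul s, x => MulOpposite.op s • x 0
  RelMap := fun r _ => r.elim

section realize

variable {M : Type v} [AddCommGroup M] [Module Sᵐᵒᵖ M] (w : α → M)

theorem realize_zero : (zero : (modLang S).Term α).realize w = 0 := rfl

theorem realize_add (x y : (modLang S).Term α) :
    (add x y).realize w = x.realize w + y.realize w := rfl

theorem realize_neg (x : (modLang S).Term α) : (neg x).realize w = -x.realize w := rfl

theorem realize_smul (x : (modLang S).Term α) (s : S) :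
    (smul x s).realize w = MulOpposite.op s • x.realize w := rfl

/-- A right `S`-module is a model of `divisibleTheory S` exactly if it is nonzero and
`M.r = M` for every nonzero `r`. -/
theorem model_divisibleTheory_iff :
    M ⊨ divisibleTheory S ↔
      Nontrivial M ∧ ∀ r : S, r ≠ 0 → ∀ x : M, ∃ y : M, MulOpposite.op r • y = x := by
  have hdiv : ∀ r : S, M ⊨ divisibleBy r ↔ ∀ x : M, ∃ y : M, MulOpposite.op r • y = x := by
    intro r
    simp [divisibleBy, Sentence.Realize, Formula.Realize, realize_smul, Fin.snoc]
  have hnz : M ⊨ nonzero S ↔ Nontrivial M := by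
    rw [nontrivial_iff_exists_ne (0 : M)]
    simp [nonzero, Sentence.Realize, Formula.Realize, realize_zero, Fin.snoc]
  rw [Theory.model_iff]
  constructor
  · intro h
    exact ⟨hnz.1 (h _ (Or.inr rfl)), fun r hr => (hdiv r).1 (h _ (Or.inl (Or.inr ⟨r, hr, rfl⟩)))⟩
  · rintro ⟨h1, h2⟩ σ ((hσ | ⟨r, hr, rfl⟩) | rfl)
    · cases hσ <;>
        simp [Sentence.Realize, Formula.Realize, realize_smul, realize_add, realize_zero,
          realize_neg, Fin.snoc, _root_.add_smul, mul_smul]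
      · exact fun _ _ _ => _root_.add_assoc _ _ _
      · exact fun _ _ => _root_.add_comm _ _
    · exact (hdiv r).2 (h2 r hr)
    · exact hnz.2 h1

theorem realize_atLeastRoots (q : S) (n : ℕ) :
    M ⊨ atLeastRoots q n ↔ (n : ℕ∞) ≤ ENat.card {x : M // MulOpposite.op q • x = 0} := by
  have h : M ⊨ atLeastRoots q n ↔
      Nonempty (Fin n ↪ {x : M // MulOpposite.op q • x = 0}) := by
    simp only [atLeastRoots, Sentence.Realize, BoundedFormula.realize_exs,
      BoundedFormula.realize_inf, BoundedFormula.realize_iInf, BoundedFormula.realize_bdEqual,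
      BoundedFormula.realize_not, realize_smul, realize_zero, Function.comp_apply,
      Term.realize_var, Sum.elim_inr]
    constructor
    · rintro ⟨x, h1, h2⟩
      refine ⟨⟨fun i => ⟨x i, h1 i⟩, fun i j hij => ?_⟩⟩
      by_contra hne
      exact h2 ⟨(i, j), hne⟩ (congrArg Subtype.val hij)
    · rintro ⟨f⟩
      exact ⟨fun i => (f i).1, fun i => (f i).2,
        fun p hp => p.2 (f.injective (Subtype.ext hp))⟩
  rw [h, ← Cardinal.lift_mk_le', ENat.card, Cardinal.natCast_le_toENat]
  simp

/-- A right `S`-module is a model of `rootCountTheory S ν` exactly if every irreducible `q`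
annihilates `ν q` elements. -/
theorem model_rootCountTheory_iff (ν : {q : S // Irreducible q} → ℕ∞) :
    M ⊨ rootCountTheory S ν ↔
      ∀ q, ENat.card {x : M // MulOpposite.op q.1 • x = 0} = ν q := by
  rw [Theory.model_iff]
  constructor
  · intro h q
    refine ENat.eq_of_forall_natCast_le_iff fun n => ?_
    rw [← realize_atLeastRoots]
    constructor
    · intro h1
      by_contra h2
      exact (Sentence.realize_not M).1 (h _ (Or.inr ⟨q, n, not_le.1 h2, rfl⟩)) h1
    · exact fun h1 => h _ (Or.inl ⟨q, n, h1, rfl⟩)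
  · rintro h σ (⟨q, n, hn, rfl⟩ | ⟨q, n, hn, rfl⟩)
    · rwa [realize_atLeastRoots, h]
    · rw [Sentence.realize_not, realize_atLeastRoots, h]
      exact not_le.2 hn

end realize

end modLang

/-- Elimination of quantifiers: modulo `T`, every formula is equivalent to a quantifier-free
formula in the same variables. -/
def HasQE {L : FirstOrder.Language.{u, v}} (T : L.Theory) : Prop :=
  ∀ (n : ℕ) (θ : L.Formula (Fin n)), ∃ ψ : L.Formula (Fin n),
    BoundedFormula.IsQF ψ ∧ θ ⇔[T] ψ

/-! Multiplication by a twisted polynomial is analysed through division. Since `φ` is injective,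
degrees add, and dividing with the quotient on the right is always possible. Hence an irreducible
`q` generates a maximal right ideal, and every nonzero element is a unit or a product of
irreducibles and units.

Fix `ν` and consider all nonzero divisible modules with root counts `ν`. A tuple in such a module
`M` is a linear map `f` from a free module to `M`. The claim is that the truth of any formula at `f`
depends only on finitely many conditions `f τ = 0`, uniformly over the class. This gives a
quantifier-free equivalent (`exists_isQF_of_finitelyDetermined`), and for sentences, where the free
module is zero, it gives completeness.

The only hard case is `∃ x` (`FinitelyDetermined₂.exists`), where the matrix depends on equations `f
τ + r • x = 0`. If some such equation with `r ≠ 0` holds, then `x` ranges over the solutions of an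
equation `r • x = c`. Factoring `r` reduces this to irreducible `q`
(`preservesDetermined_of_maximal`): each equation on `x` either involves only `q • x`, or singles
out one candidate for `x`. Whether a solution of `q • x = c` avoids the finitely many candidates is
a matter of counting, and `ν q` is the size of every fibre. If no equation with `r ≠ 0` holds, `x`
is generic, and generic elements always exist, because an infinite divisible module is not a finite
union of such solution sets (`exists_forall_smul_ne`).

A complete `T` then shares a model with the theory for the `ν` read off from that model, so the two
have the same consequences. -/

namespace TwistedPoly

/-! ### Division, common divisors and factorization in `K[t;φ]`. -/

variable {K : Type u} [Field K] {φ : K →+* K}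

/-- The coefficient of `tⁿ`. -/
def coeff (p : TwistedPoly φ) (n : ℕ) : K := DFunLike.coe (F := ℕ →₀ K) p n

/-- The twisted polynomial `tⁿ a`. -/
noncomputable def monomial (n : ℕ) (a : K) : TwistedPoly φ := (Finsupp.single n a : ℕ →₀ K)

/-- The degree, with the convention that `0` has degree `0`. -/
noncomputable def natDegree (p : TwistedPoly φ) : ℕ := (Finsupp.support (M := K) p).sup id

@[ext]
theorem ext {p q : TwistedPoly φ} (h : ∀ n, p.coeff n = q.coeff n) : p = q :=
  Finsupp.ext (M := K) h

@[simp]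
theorem coeff_zero (n : ℕ) : (0 : TwistedPoly φ).coeff n = 0 := rfl

@[simp]
theorem coeff_sub (p q : TwistedPoly φ) (n : ℕ) : (p - q).coeff n = p.coeff n - q.coeff n := rfl

theorem coeff_monomial (n : ℕ) (a : K) (i : ℕ) :
    (monomial n a : TwistedPoly φ).coeff i = if n = i then a else 0 :=
  Finsupp.single_apply (M := K)

theorem coeff_mul (p q : TwistedPoly φ) (i : ℕ) :
    (p * q).coeff i =
      ∑ x ∈ Finset.HasAntidiagonal.antidiagonal i, φ^[x.2] (p.coeff x.1) * q.coeff x.2 :=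
  twistedMul.coeff p q i

theorem coeff_mul_add_of_le {p q : TwistedPoly φ} {m n : ℕ} (hp : ∀ i, m < i → p.coeff i = 0)
    (hq : ∀ i, n < i → q.coeff i = 0) :
    (p * q).coeff (m + n) = φ^[n] (p.coeff m) * q.coeff n := by
  rw [coeff_mul, Finset.sum_eq_single (m, n)]
  · rintro ⟨i, j⟩ hij hne
    rw [Finset.HasAntidiagonal.mem_antidiagonal] at hij
    rcases lt_trichotomy m i with h | h | h
    · simp [hp i h, iterate_map_zero]
    · exact absurd (by ext <;> simp <;> omega) hne
    · rw [hq j (by simp at hij; omega), mul_zero]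
  · simp

theorem coeff_mul_eq_zero {p q : TwistedPoly φ} {m n : ℕ} (hp : ∀ i, m < i → p.coeff i = 0)
    (hq : ∀ i, n < i → q.coeff i = 0) {k : ℕ} (hk : m + n < k) : (p * q).coeff k = 0 := by
  rw [coeff_mul]
  refine Finset.sum_eq_zero ?_
  rintro ⟨i, j⟩ hij
  rw [Finset.HasAntidiagonal.mem_antidiagonal] at hij
  by_cases h : m < i
  · simp [hp i h, iterate_map_zero]
  · rw [hq j (by simp at hij; omega), mul_zero]

theorem coeff_natDegree_ne_zero {p : TwistedPoly φ} (hp : p ≠ 0) : p.coeff p.natDegree ≠ 0 := by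
  have hs : (Finsupp.support (M := K) p).Nonempty := Finsupp.support_nonempty_iff.2 hp
  obtain ⟨i, hi, h⟩ := Finset.exists_mem_eq_sup _ hs id
  rw [natDegree, h]
  exact Finsupp.mem_support_iff.1 hi

theorem coeff_eq_zero_of_natDegree_lt (p : TwistedPoly φ) (i : ℕ) (hi : p.natDegree < i) :
    p.coeff i = 0 := by
  by_contra h
  exact absurd (Finset.le_sup (f := id) (Finsupp.mem_support_iff (M := K).2 h)) (not_le.2 hi)

/-- The case `p = 0` is separate because `natDegree 0 = 0`, which is not below `m = 0`. -/
theorem eq_zero_or_natDegree_lt {p : TwistedPoly φ} {m : ℕ} (h : ∀ i, m ≤ i → p.coeff i = 0) :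
    p = 0 ∨ p.natDegree < m := by
  by_contra! hp
  exact coeff_natDegree_ne_zero hp.1 (h _ hp.2)

/-- The top coefficient is a power of `φ` applied to one leading coefficient, times the other; a
ring endomorphism of a field is injective. -/
theorem coeff_mul_natDegree_ne_zero {p q : TwistedPoly φ} (hp : p ≠ 0) (hq : q ≠ 0) :
    (p * q).coeff (p.natDegree + q.natDegree) ≠ 0 := by
  rw [coeff_mul_add_of_le p.coeff_eq_zero_of_natDegree_lt q.coeff_eq_zero_of_natDegree_lt]
  refine mul_ne_zero ?_ (coeff_natDegree_ne_zero hq)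
  rw [← RingHom.coe_pow]
  exact (map_ne_zero _).2 (coeff_natDegree_ne_zero hp)

instance : NoZeroDivisors (TwistedPoly φ) where
  eq_zero_or_eq_zero_of_mul_eq_zero {p q} h := by
    by_contra! hpq
    exact coeff_mul_natDegree_ne_zero hpq.1 hpq.2 (by rw [h, coeff_zero])

instance : Infinite (TwistedPoly φ) := inferInstanceAs (Infinite (ℕ →₀ K))

theorem natDegree_mul {p q : TwistedPoly φ} (hp : p ≠ 0) (hq : q ≠ 0) :
    (p * q).natDegree = p.natDegree + q.natDegree := by
  refine le_antisymm ?_ ?_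
  · by_contra! h
    exact coeff_natDegree_ne_zero (mul_ne_zero hp hq) (coeff_mul_eq_zero
      p.coeff_eq_zero_of_natDegree_lt q.coeff_eq_zero_of_natDegree_lt h)
  · by_contra! h
    exact coeff_mul_natDegree_ne_zero hp hq (coeff_eq_zero_of_natDegree_lt _ _ h)

theorem isUnit_of_natDegree_eq_zero {p : TwistedPoly φ} (hp : p ≠ 0) (h : p.natDegree = 0) :
    IsUnit p := by
  have hc := coeff_natDegree_ne_zero hp
  rw [h] at hc
  have hpc : p = monomial 0 (p.coeff 0) := by
    ext i
    rw [coeff_monomial]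
    split_ifs with hi
    · rw [hi]
    · exact coeff_eq_zero_of_natDegree_lt _ _ (by omega)
  have hmul : ∀ a b : K, (monomial 0 a * monomial 0 b : TwistedPoly φ) = monomial 0 (a * b) :=
    fun a b => twistedMul.single_mul_single 0 0 a b
  rw [hpc]
  refine ⟨⟨monomial 0 (p.coeff 0), monomial 0 (p.coeff 0)⁻¹, ?_, ?_⟩, rfl⟩
  · rw [hmul, mul_inv_cancel₀ hc]; rfl
  · rw [hmul, inv_mul_cancel₀ hc]; rfl

/-- One step of right division: the leading term of `p` is cancelled by a multiple of `q`. -/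
theorem exists_sub_mul_natDegree_lt {p q : TwistedPoly φ} (hq : q ≠ 0)
    (h : q.natDegree ≤ p.natDegree) :
    ∃ s, p - q * s = 0 ∨ (p - q * s).natDegree < p.natDegree := by
  set k := p.natDegree - q.natDegree with hk
  have hb : φ^[k] (q.coeff q.natDegree) ≠ 0 := by
    rw [← RingHom.coe_pow]
    exact (map_ne_zero _).2 (coeff_natDegree_ne_zero hq)
  -- The product `q * tᵏ b` has leading coefficient `φᵏ(lc q) b`, so only a value of `φ` has to be
  -- inverted; `φ` need not be surjective.
  set s : TwistedPoly φ := monomial k ((φ^[k] (q.coeff q.natDegree))⁻¹ * p.coeff p.natDegree)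
  have hs : ∀ i, k < i → s.coeff i = 0 := fun i hi => by
    rw [coeff_monomial, if_neg hi.ne]
  refine ⟨s, eq_zero_or_natDegree_lt fun i hi => ?_⟩
  rw [coeff_sub]
  rcases hi.eq_or_lt with rfl | hi
  · have := coeff_mul_add_of_le q.coeff_eq_zero_of_natDegree_lt hs
    rw [coeff_monomial, if_pos rfl, mul_inv_cancel_left₀ hb,
      show q.natDegree + k = p.natDegree by omega] at this
    rw [this, sub_self]
  · rw [coeff_eq_zero_of_natDegree_lt _ _ hi,
      coeff_mul_eq_zero q.coeff_eq_zero_of_natDegree_lt hs (by omega), sub_self]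

theorem exists_sub_mul_eq_zero_or_natDegree_lt (p : TwistedPoly φ) {q : TwistedPoly φ}
    (hq : q ≠ 0) : ∃ s, p - q * s = 0 ∨ (p - q * s).natDegree < q.natDegree := by
  induction hn : p.natDegree using Nat.strong_induction_on generalizing p with
  | _ n ih =>
    by_cases h : q.natDegree ≤ p.natDegree
    · obtain ⟨s, hs | hs⟩ := exists_sub_mul_natDegree_lt hq h
      · exact ⟨s, Or.inl hs⟩
      · obtain ⟨s', hs'⟩ := ih _ (hn ▸ hs) _ rfl
        refine ⟨s + s', ?_⟩
        rwa [_root_.mul_add, ← sub_sub]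
    · exact ⟨0, Or.inr (by simpa using h)⟩

/-- Right ideals with two generators are principal. -/
theorem exists_gcd (q r : TwistedPoly φ) (hq : q ≠ 0) :
    ∃ u v s s', q = (q * u + r * v) * s ∧ r = (q * u + r * v) * s' := by
  -- A nonzero element of least degree in the right ideal `qR + rR` generates it.
  obtain ⟨h, ⟨⟨u, v, rfl⟩, h0⟩, hmin⟩ := (measure (natDegree (φ := φ))).wf.has_min
    {h | (∃ u v, h = q * u + r * v) ∧ h ≠ 0} ⟨q, ⟨1, 0, by simp⟩, hq⟩
  have key : ∀ x, (∃ u v, x = q * u + r * v) → ∃ s, x = (q * u + r * v) * s := by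
    rintro x ⟨u', v', rfl⟩
    obtain ⟨s, hs⟩ := exists_sub_mul_eq_zero_or_natDegree_lt (q * u' + r * v') h0
    refine ⟨s, sub_eq_zero.1 ?_⟩
    by_contra hne
    refine hmin _ ⟨⟨u' - u * s, v' - v * s, ?_⟩, hne⟩ (hs.resolve_left hne)
    noncomm_ring
  obtain ⟨s, hs⟩ := key q ⟨1, 0, by simp⟩
  obtain ⟨s', hs'⟩ := key r ⟨0, 1, by simp⟩
  exact ⟨u, v, s, s', hs, hs'⟩

/-- An irreducible element generates a maximal right ideal. -/
theorem eq_mul_or_add_eq_one_of_irreducible {q : TwistedPoly φ} (hq : Irreducible q)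
    (r : TwistedPoly φ) : (∃ s, r = q * s) ∨ ∃ u v, q * u + r * v = 1 := by
  obtain ⟨u, v, s, s', hs, hs'⟩ := exists_gcd q r hq.ne_zero
  set h := q * u + r * v
  -- In `q = h * s` one factor is a unit: if `h` is, rescaling gives `1`; if `s` is, then `q`
  -- divides everything that `h` divides.
  rcases hq.isUnit_or_isUnit hs with ⟨w, hw⟩ | ⟨w, hw⟩
  · refine Or.inr ⟨u * ↑w⁻¹, v * ↑w⁻¹, ?_⟩
    rw [← mul_assoc, ← mul_assoc, ← _root_.add_mul]
    change h * _ = 1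
    rw [← hw, Units.mul_inv]
  · refine Or.inl ⟨↑w⁻¹ * s', ?_⟩
    rw [hs, ← hw, mul_assoc, Units.mul_inv_cancel_left]
    exact hs'

/-- Induction on a factorization into irreducible elements. -/
theorem induction_on_factors {motive : TwistedPoly φ → Prop} {g : TwistedPoly φ} (hg : g ≠ 0)
    (unit : ∀ g, IsUnit g → motive g) (irreducible : ∀ g, Irreducible g → motive g)
    (mul : ∀ g h, motive g → motive h → motive (g * h)) : motive g := by
  induction hn : g.natDegree using Nat.strong_induction_on generalizing g with
  | _ n ih =>
    by_cases hu : IsUnit g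
    · exact unit g hu
    by_cases hi : Irreducible g
    · exact irreducible g hi
    rw [irreducible_iff] at hi
    push Not at hi
    obtain ⟨a, b, rfl, ha, hb⟩ := hi hu
    have ha0 : a ≠ 0 := left_ne_zero_of_mul hg
    have hb0 : b ≠ 0 := right_ne_zero_of_mul hg
    have h := natDegree_mul ha0 hb0
    have ha' := mt (isUnit_of_natDegree_eq_zero ha0) ha
    have hb' := mt (isUnit_of_natDegree_eq_zero hb0) hb
    exact mul a b (ih _ (by omega) ha0 rfl) (ih _ (by omega) hb0 rfl)

end TwistedPoly

/-! ### Properties determined by finitely many linear equations. -/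

section FinitelyDetermined

universe w

variable {A : Type u} [Ring A] {F : Type v} [AddCommGroup F] [Module A F]

/-- A property of linear maps from `F` to modules in `𝒞` is finitely determined if it depends only
on which elements of some finite subset of `F` are sent to `0`. -/
def FinitelyDetermined (𝒞 : Set (ModuleCat.{w} A))
    (P : ∀ M : ModuleCat.{w} A, (F →ₗ[A] M) → Prop) : Prop :=
  ∃ G : Finset F, ∀ M ∈ 𝒞, ∀ N ∈ 𝒞, ∀ (f : F →ₗ[A] M) (g : F →ₗ[A] N),
    (∀ τ ∈ G, f τ = 0 ↔ g τ = 0) → P M f → P N g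

/-- The variant of `FinitelyDetermined` for a linear map together with an element: the property
depends only on the truth of finitely many equations `f τ + r • x = 0`. -/
def FinitelyDetermined₂ (𝒞 : Set (ModuleCat.{w} A))
    (P : ∀ M : ModuleCat.{w} A, (F →ₗ[A] M) → M → Prop) : Prop :=
  ∃ G : Finset (F × A), ∀ M ∈ 𝒞, ∀ N ∈ 𝒞, ∀ (f : F →ₗ[A] M) (g : F →ₗ[A] N) (x : M) (y : N),
    (∀ p ∈ G, f p.1 + p.2 • x = 0 ↔ g p.1 + p.2 • y = 0) → P M f x → P N g y

/-- Quantification over the solutions of `g • x = c` preserves finite determination. -/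
def PreservesDetermined (F : Type v) [AddCommGroup F] [Module A F] (𝒞 : Set (ModuleCat.{w} A))
    (g : A) : Prop :=
  ∀ P : ∀ M : ModuleCat.{w} A, (F →ₗ[A] M) → M → Prop, FinitelyDetermined₂ 𝒞 P →
    FinitelyDetermined₂ 𝒞 fun M f c => ∃ x, g • x = c ∧ P M f x

variable {𝒞 : Set (ModuleCat.{w} A)}

/-- Quantifying over solutions of `(g * h) • x = c` is quantifying over `z` with `g • z = c`, then
over `x` with `h • x = z`. -/
theorem PreservesDetermined.mul {g h : A} (hg : PreservesDetermined F 𝒞 g)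
    (hh : PreservesDetermined F 𝒞 h) : PreservesDetermined F 𝒞 (g * h) := by
  intro P hP
  obtain ⟨G, hG⟩ := hg _ (hh P hP)
  refine ⟨G, fun M hM N hN f f' c c' hc => ?_⟩
  rintro ⟨x, hx, hPx⟩
  obtain ⟨z, hz, y, hy, hPy⟩ :=
    hG M hM N hN f f' c c' hc ⟨h • x, by rw [← mul_smul, hx], x, rfl, hPx⟩
  exact ⟨y, by rw [mul_smul, hy, hz], hPy⟩

theorem preservesDetermined_of_isUnit {g : A} (hg : IsUnit g) : PreservesDetermined F 𝒞 g := by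
  classical
  obtain ⟨w, rfl⟩ := hg
  rintro P ⟨G, hG⟩
  -- The unique solution `w⁻¹ • c` is substituted into the equations.
  refine ⟨G.image fun p => (p.1, p.2 * ↑w⁻¹), fun M hM N hN f f' c c' hc => ?_⟩
  rintro ⟨x, hx, hPx⟩
  have hx' : x = (↑w⁻¹ : A) • c := by rw [← hx, ← mul_smul, Units.inv_mul, one_smul]
  refine ⟨(↑w⁻¹ : A) • c', by rw [← mul_smul, Units.mul_inv, one_smul],
    hG M hM N hN f f' x _ (fun p hp => ?_) hPx⟩
  have := hc _ (Finset.mem_image_of_mem _ hp)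
  rwa [mul_smul, ← hx', mul_smul] at this

theorem card_fiber_smul {M : Type*} [AddCommGroup M] [Module A M] (q : A) {c x₀ : M}
    (h : q • x₀ = c) : ENat.card {x : M // q • x = c} = ENat.card {x : M // q • x = 0} :=
  ENat.card_congr ((Equiv.subRight x₀).subtypeEquiv fun x => by
    simp [smul_sub, h, sub_eq_zero])

/-- An equation `f τ + r • x = 0` restricted to solutions of `q • x = c`, for `q` generating a
maximal left ideal, is an equation in `f` and `c`, possibly together with an equation that gives
the value of `x`. -/
theorem exists_reduce_of_maximal {q : A}
    (hq : ∀ r : A, (∃ s, r = s * q) ∨ ∃ u v, u * q + v * r = 1) (p : F × A) :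
    ∃ k e : F × A,
      (∀ (M : ModuleCat.{w} A) (f : F →ₗ[A] M) (x : M),
        f p.1 + p.2 • x = 0 ↔ f k.1 + k.2 • q • x = 0) ∨
      (∀ (M : ModuleCat.{w} A) (f : F →ₗ[A] M) (x : M),
        f p.1 + p.2 • x = 0 ↔ f e.1 + e.2 • q • x = x ∧ f k.1 + k.2 • q • x = 0) := by
  obtain ⟨τ, r⟩ := p
  rcases hq r with ⟨s, rfl⟩ | ⟨u, v, h⟩
  · exact ⟨(τ, s), 0, Or.inl fun M f x => by rw [mul_smul]⟩
  -- By `u * q + v * r = 1`, a solution must equal the candidate `e = u • q • x - v • f τ`; the pair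
  -- `k` says that this candidate satisfies the equation.
  · refine ⟨(τ - (r * v) • τ, r * u), (-(v • τ), u), Or.inr fun M f x => ?_⟩
    have hx : u • q • x + v • r • x = x := by
      rw [← mul_smul, ← mul_smul, ← add_smul, h, one_smul]
    have key : f τ - (r * v) • f τ + (r * u) • q • x =
        f τ + r • (-(v • f τ) + u • q • x) := by
      rw [smul_add, smul_neg, mul_smul, mul_smul, ← add_assoc, sub_eq_add_neg]
    simp only [map_sub, map_neg, map_smul, key]
    constructor
    · intro h0
      have h1 : -(v • f τ) + u • q • x = x := by
        rw [eq_neg_of_add_eq_zero_left h0, smul_neg, neg_neg, add_comm, hx]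
      exact ⟨h1, by rw [h1, h0]⟩
    · rintro ⟨h1, h2⟩
      rwa [h1] at h2

/-- Counting solutions of `q • x = c` among finitely many terms, in two modules at once: a solution
outside the terms in the first module yields one in the second. -/
theorem exists_fiber_not_mem {ι M N : Type*} [AddCommGroup M] [Module A M] [AddCommGroup N]
    [Module A N] {q : A} (hcard : ENat.card {x : M // q • x = 0} = ENat.card {x : N // q • x = 0})
    {c : M} {c' y₀ : N} (hy₀ : q • y₀ = c') (s : Finset ι) (a : ι → M) (b : ι → N)
    (hab : ∀ i ∈ s, ∀ j ∈ s, a i = a j ↔ b i = b j) (hq : ∀ i ∈ s, q • a i = c ↔ q • b i = c')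
    {x : M} (hx : q • x = c) (hxs : ∀ i ∈ s, a i ≠ x) : ∃ y, q • y = c' ∧ ∀ i ∈ s, b i ≠ y := by
  by_contra! h
  have h' : ∀ y : {y : N // q • y = c'}, ∃ i ∈ s, b i = y := fun y => h y y.2
  choose i his hi using h'
  have hfin : Finite {y : N // q • y = c'} := by
    refine Finite.of_injective (β := s) (fun y => ⟨i y, his y⟩) fun y z hyz => ?_
    have : i y = i z := congrArg Subtype.val hyz
    exact Subtype.ext (by rw [← hi y, ← hi z, this])
  -- If the terms exhaust the fibre over `c'`, the corresponding terms in `M` together with the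
  -- extra point `x` give one more element in the fibre over `c`, although both fibres have the same
  -- size.
  let j : Option {y : N // q • y = c'} → {x : M // q • x = c} := fun o =>
    o.elim ⟨x, hx⟩ fun y => ⟨a (i y), (hq _ (his y)).2 (by rw [hi y, y.2])⟩
  have hj : Function.Injective j := by
    rintro (_ | y) (_ | z) hyz
    · rfl
    · exact absurd (congrArg Subtype.val hyz).symm (hxs _ (his z))
    · exact absurd (congrArg Subtype.val hyz) (hxs _ (his y))
    · have := (hab _ (his y) _ (his z)).1 (congrArg Subtype.val hyz)
      rw [hi y, hi z] at this
      rw [Subtype.ext this]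
  have hle := ENat.card_le_card_of_injective hj
  rw [card_fiber_smul q hx, hcard, ← card_fiber_smul q hy₀, ENat.card_eq_coe_natCard,
    ENat.card_eq_coe_natCard, Nat.cast_le, Finite.card_option] at hle
  omega

theorem preservesDetermined_of_maximal {q : A}
    (hq : ∀ r : A, (∃ s, r = s * q) ∨ ∃ u v, u * q + v * r = 1)
    (hdiv : ∀ M ∈ 𝒞, ∀ x : M, ∃ y : M, q • y = x)
    (hcard : ∀ M ∈ 𝒞, ∀ N ∈ 𝒞,
      ENat.card {x : M // q • x = 0} = ENat.card {x : N // q • x = 0}) :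
    PreservesDetermined F 𝒞 q := by
  classical
  rintro P ⟨G, hG⟩
  choose k e hke using exists_reduce_of_maximal.{u, v, w} (F := F) hq
  -- Three families of equations: the conditions `k`, the coincidences between candidates, and the
  -- conditions that a candidate lies in the fibre over `c`.
  refine ⟨G.image k ∪ (G ×ˢ G).image (fun p => e p.1 - e p.2) ∪
    G.image fun p => q • e p - (0, 1), fun M hM N hN f g c c' hc => ?_⟩
  have hk : ∀ p ∈ G, f (k p).1 + (k p).2 • c = 0 ↔ g (k p).1 + (k p).2 • c' = 0 := fun p hp =>
    hc _ (Finset.mem_union_left _ (Finset.mem_union_left _ (Finset.mem_image_of_mem _ hp)))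
  have he : ∀ p ∈ G, ∀ p' ∈ G,
      f (e p).1 + (e p).2 • c = f (e p').1 + (e p').2 • c ↔
        g (e p).1 + (e p).2 • c' = g (e p').1 + (e p').2 • c' := fun p hp p' hp' => by
    have := hc _ (Finset.mem_union_left _ (Finset.mem_union_right _
      (Finset.mem_image_of_mem _ (Finset.mk_mem_product hp hp'))))
    simp only [Prod.fst_sub, Prod.snd_sub, map_sub, sub_smul, sub_add_sub_comm] at this
    rwa [sub_eq_zero, sub_eq_zero] at this
  have hqe : ∀ p ∈ G,
      q • (f (e p).1 + (e p).2 • c) = c ↔ q • (g (e p).1 + (e p).2 • c') = c' := fun p hp => by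
    have := hc _ (Finset.mem_union_right _ (Finset.mem_image_of_mem _ hp))
    simp only [Prod.fst_sub, Prod.snd_sub, Prod.smul_fst, Prod.smul_snd, sub_zero, map_smul,
      sub_smul, one_smul, smul_assoc, ← add_sub_assoc, ← smul_add] at this
    rwa [sub_eq_zero, sub_eq_zero] at this
  rintro ⟨x, rfl, hPx⟩
  suffices ∃ y, q • y = c' ∧ ∀ p ∈ G,
      f (e p).1 + (e p).2 • q • x = x ↔ g (e p).1 + (e p).2 • c' = y by
    obtain ⟨y, rfl, hy⟩ := this
    refine ⟨y, rfl, hG M hM N hN f g x y (fun p hp => ?_) hPx⟩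
    rcases hke p with h | h
    · rw [h M f x, h N g y, hk p hp]
    · rw [h M f x, h N g y, hk p hp, hy p hp]
  -- If `x` is a candidate, the same candidate in `N` serves as `y`; otherwise counting provides a
  -- `y` that is none of the candidates.
  by_cases hx : ∃ p ∈ G, f (e p).1 + (e p).2 • q • x = x
  · obtain ⟨p, hp, hpx⟩ := hx
    refine ⟨_, (hqe p hp).1 (by rw [hpx]), fun p' hp' => ?_⟩
    rw [← he p' hp' p hp, hpx]
  · push Not at hx
    obtain ⟨y₀, hy₀⟩ := hdiv N hN c'
    obtain ⟨y, hy, hyG⟩ := exists_fiber_not_mem (hcard M hM N hN) hy₀ G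
      (fun p => f (e p).1 + (e p).2 • q • x) (fun p => g (e p).1 + (e p).2 • c') he hqe rfl hx
    exact ⟨y, hy, fun p hp => iff_of_false (hx p hp) (hyG p hp)⟩

/-- Finitely many equations `r • y = d` with `r` acting surjectively do not cover an infinite
module. -/
theorem exists_forall_smul_ne {ι M : Type*} [AddCommGroup M] [Module A M] [Infinite M]
    (s : Finset ι) (r : ι → A) (d : ι → M) (hr : ∀ i ∈ s, ∀ x : M, ∃ y, r i • y = x) :
    ∃ y, ∀ i ∈ s, r i • y ≠ d i := by
  by_contra! h
  choose! y₀ hy₀ using hr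
  -- B. H. Neumann's lemma: the solution sets are cosets of the kernels of the `r i`, so if they
  -- covered `M`, some kernel would have finite index. But `M` modulo that kernel is isomorphic to
  -- the infinite `M`.
  obtain ⟨i, hi, hfin⟩ := AddSubgroup.exists_finiteIndex_of_leftCoset_cover (s := s)
    (H := fun i => (DistribSMul.toAddMonoidHom M (r i)).ker) (g := fun i => y₀ i (d i)) <| by
      refine Set.eq_univ_of_forall fun y => ?_
      obtain ⟨i, hi, hy⟩ := h y
      refine Set.mem_biUnion hi ?_
      rw [mem_leftAddCoset_iff]
      simp [AddMonoidHom.mem_ker, hy₀ i hi, hy]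
  have hsurj : Function.Surjective (DistribSMul.toAddMonoidHom M (r i)) :=
    fun x => ⟨y₀ i x, hy₀ i hi x⟩
  have := (QuotientAddGroup.quotientKerEquivOfSurjective _ hsurj).toEquiv.finite_iff.1 inferInstance
  exact not_finite M

/-- Existential quantification preserves finite determination. -/
theorem FinitelyDetermined₂.exists
    (hpres : ∀ r : A, r ≠ 0 → PreservesDetermined F 𝒞 r) (hinf : ∀ M ∈ 𝒞, Infinite M)
    (hdiv : ∀ M ∈ 𝒞, ∀ r : A, r ≠ 0 → ∀ x : M, ∃ y : M, r • y = x)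
    {P : ∀ M : ModuleCat.{w} A, (F →ₗ[A] M) → M → Prop} (hP : FinitelyDetermined₂ 𝒞 P) :
    FinitelyDetermined 𝒞 fun M f => ∃ x, P M f x := by
  classical
  have hpres' := fun r hr => hpres r hr P hP
  obtain ⟨G, hG⟩ := hP
  choose! H hH using hpres'
  -- The first family covers the equations in which `x` has coefficient `0`; the second substitutes
  -- `c = -f p.1` into the conditions for the fibre `p.2 • x = c`.
  refine ⟨G.image Prod.fst ∪ G.biUnion fun p => (H p.2).image fun z => z.1 - z.2 • p.1,
    fun M hM N hN f g hfg => ?_⟩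
  rintro ⟨x, hx⟩
  by_cases hex : ∃ p ∈ G, p.2 ≠ 0 ∧ f p.1 + p.2 • x = 0
  · obtain ⟨p, hp, hp0, hpx⟩ := hex
    obtain ⟨y, -, hy⟩ := hH p.2 hp0 M hM N hN f g (f (-p.1)) (g (-p.1)) (fun z hz => by
      have := hfg _ (Finset.mem_union_right _
        (Finset.mem_biUnion.2 ⟨p, hp, Finset.mem_image_of_mem _ hz⟩))
      simp only [map_sub, map_smul] at this
      simpa only [map_neg, smul_neg, ← sub_eq_add_neg] using this)
      ⟨x, by rw [map_neg, eq_neg_of_add_eq_zero_right hpx], hx⟩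
    exact ⟨y, hy⟩
  -- Here `x` satisfies no equation with nonzero coefficient, and any such generic `y` in `N` can
  -- replace it.
  · push Not at hex
    have := hinf N hN
    obtain ⟨y, hy⟩ := exists_forall_smul_ne (M := N) (G.filter (·.2 ≠ 0)) (fun p => p.2)
      (fun p => -g p.1) fun p hp => hdiv N hN _ (Finset.mem_filter.1 hp).2
    refine ⟨y, hG M hM N hN f g x y (fun p hp => ?_) hx⟩
    by_cases hp0 : p.2 = 0
    · simpa [hp0] using hfg _ (Finset.mem_union_left _ (Finset.mem_image_of_mem _ hp))
    · refine iff_of_false (hex p hp hp0) fun h => ?_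
      exact hy p (Finset.mem_filter.2 ⟨hp, hp0⟩) (eq_neg_of_add_eq_zero_right h)

/-- The condition on `f` and `g` is symmetric, so the premise can be carried backwards from `g` to
`f`. -/
theorem FinitelyDetermined.imp {P Q : ∀ M : ModuleCat.{w} A, (F →ₗ[A] M) → Prop}
    (hP : FinitelyDetermined 𝒞 P) (hQ : FinitelyDetermined 𝒞 Q) :
    FinitelyDetermined 𝒞 fun M f => P M f → Q M f := by
  classical
  obtain ⟨G, hG⟩ := hP
  obtain ⟨H, hH⟩ := hQ
  exact ⟨G ∪ H, fun M hM N hN f g hfg hPQ hN' =>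
    hH M hM N hN f g (fun τ hτ => hfg τ (Finset.mem_union_right _ hτ))
      (hPQ (hG N hN M hM g f (fun τ hτ => (hfg τ (Finset.mem_union_left _ hτ)).symm) hN'))⟩

theorem finitelyDetermined_false : FinitelyDetermined 𝒞 fun M (_ : F →ₗ[A] M) => False :=
  ⟨∅, fun _ _ _ _ _ _ _ h => h⟩

theorem FinitelyDetermined.not {P : ∀ M : ModuleCat.{w} A, (F →ₗ[A] M) → Prop}
    (hP : FinitelyDetermined 𝒞 P) : FinitelyDetermined 𝒞 fun M f => ¬ P M f :=
  hP.imp finitelyDetermined_false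

/-- Regard the image of a distinguished part of `F'` as a separate element. -/
theorem FinitelyDetermined.comp_coprod {F' : Type*} [AddCommGroup F'] [Module A F']
    {P : ∀ M : ModuleCat.{w} A, (F' →ₗ[A] M) → Prop} (hP : FinitelyDetermined 𝒞 P)
    (ρ : F' →ₗ[A] F × A) :
    FinitelyDetermined₂ 𝒞 fun M f x => P M (f.coprod (LinearMap.toSpanSingleton A M x) ∘ₗ ρ) := by
  classical
  obtain ⟨G, hG⟩ := hP
  refine ⟨G.image ρ, fun M hM N hN f g x y hfg => hG M hM N hN _ _ fun τ hτ => ?_⟩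
  simpa using hfg _ (Finset.mem_image_of_mem _ hτ)

end FinitelyDetermined

/-! ### From formulas to finitely determined properties and back. -/

namespace modLang

universe w

variable {S : Type u} [Ring S]

/-- A structure satisfying the axioms of right modules comes from a right module. -/
theorem exists_module_of_axioms {M : Type w} [inst : (modLang S).Structure M]
    (h : ∀ σ, IsModuleAxiom S σ → M ⊨ σ) :
    ∃ (_ : AddCommGroup M) (_ : Module Sᵐᵒᵖ M), inst = instStructureOfModuleMulOpposite M := by
  let z : M := inst.funMap (ModFunc.zero : ModFunc S 0) ![]
  let a : M → M → M := fun x y => inst.funMap (ModFunc.add : ModFunc S 2) ![x, y]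
  let n : M → M := fun x => inst.funMap (ModFunc.neg : ModFunc S 1) ![x]
  let m : S → M → M := fun s x => inst.funMap (ModFunc.smul s : ModFunc S 1) ![x]
  have hz : ∀ {α : Type} (w : α → M), (zero : (modLang S).Term α).realize w = z := fun w =>
    congrArg (inst.funMap (ModFunc.zero : ModFunc S 0)) (Subsingleton.elim _ _)
  have ha : ∀ {α : Type} (w : α → M) (x y : (modLang S).Term α),
      (add x y).realize w = a (x.realize w) (y.realize w) := fun w x y =>
    Term.realize_functions_apply₂
  have hn : ∀ {α : Type} (w : α → M) (x : (modLang S).Term α),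
      (neg x).realize w = n (x.realize w) := fun w x => Term.realize_functions_apply₁
  have hm : ∀ {α : Type} (w : α → M) (x : (modLang S).Term α) (s : S),
      (smul x s).realize w = m s (x.realize w) := fun w x s => Term.realize_functions_apply₁
  have add_assoc := h _ .add_assoc
  have add_comm := h _ .add_comm
  have add_zero := h _ .add_zero
  have add_neg := h _ .add_neg
  have smul_one := h _ .smul_one
  have smul_mul := fun r s => h _ (.smul_mul r s)
  have smul_add := fun r s => h _ (.smul_add r s)
  have add_smul := fun r => h _ (.add_smul r)
  simp [Sentence.Realize, Formula.Realize, hz, ha, hn, Fin.snoc] at add_assoc add_comm add_zero add_neg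
  simp [Sentence.Realize, Formula.Realize, hm, Fin.snoc] at smul_one smul_mul
  simp [Sentence.Realize, Formula.Realize, ha, hm, Fin.snoc] at smul_add add_smul
  let _ : Add M := ⟨a⟩
  let _ : Zero M := ⟨z⟩
  let _ : Neg M := ⟨n⟩
  let G : AddCommGroup M :=
    { add_assoc := add_assoc
      zero_add := fun x => (add_comm z x).trans (add_zero x)
      add_zero := add_zero
      nsmul := nsmulRec
      zsmul := zsmulRec
      neg_add_cancel := fun x => (add_comm (n x) x).trans (add_neg x)
      add_comm := add_comm }
  have m_add : ∀ r (x y : M), m r (x + y) = m r x + m r y := add_smul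
  let D : Module Sᵐᵒᵖ M :=
    { smul := fun s x => m s.unop x
      one_smul := smul_one
      mul_smul := fun r s x => smul_mul s.unop r.unop x
      smul_zero := fun r => by
        have := m_add r.unop 0 0
        rw [_root_.add_zero] at this
        exact left_eq_add.1 this
      smul_add := fun r x y => m_add r.unop x y
      add_smul := fun r s x => smul_add r.unop s.unop x
      zero_smul := fun x => by
        have : m (0 + 0) x = m 0 x + m 0 x := smul_add 0 0 x
        rw [_root_.add_zero] at this
        exact left_eq_add.1 this }
  refine ⟨G, D, ?_⟩
  have hvec₁ : ∀ x : Fin 1 → M, x = ![x 0] := fun x => by ext i; fin_cases i; rfl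
  have hvec₂ : ∀ x : Fin 2 → M, x = ![x 0, x 1] := fun x => by ext i; fin_cases i <;> rfl
  refine Structure.ext ?_ (funext fun k => funext fun r => r.elim)
  funext k f x
  cases f with
  | zero => exact congrArg _ (Subsingleton.elim _ _)
  | add => exact congrArg _ (hvec₂ x)
  | neg => exact congrArg _ (hvec₁ x)
  | smul s => exact congrArg _ (hvec₁ x)

variable {β : Type v}

/-- Every term is a linear combination of its variables. -/
theorem exists_linear_of_term (t : (modLang S).Term β) :
    ∃ τ : β →₀ Sᵐᵒᵖ, ∀ (M : ModuleCat.{w} Sᵐᵒᵖ) (f : (β →₀ Sᵐᵒᵖ) →ₗ[Sᵐᵒᵖ] M),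
      t.realize (fun i => f (Finsupp.single i 1)) = f τ := by
  induction t with
  | var i => exact ⟨Finsupp.single i 1, fun M f => rfl⟩
  | func F ts ih =>
    choose τ hτ using ih
    cases F with
    | zero => exact ⟨0, fun M f => (map_zero f).symm⟩
    | add =>
      refine ⟨τ 0 + τ 1, fun M f => ?_⟩
      rw [map_add, ← hτ, ← hτ]
      rfl
    | neg =>
      refine ⟨-τ 0, fun M f => ?_⟩
      rw [map_neg, ← hτ]
      rfl
    | smul s =>
      refine ⟨MulOpposite.op s • τ 0, fun M f => ?_⟩
      rw [map_smul, ← hτ]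
      rfl

/-- Every linear combination of variables is given by a term. -/
theorem exists_term_of_linear (τ : β →₀ Sᵐᵒᵖ) :
    ∃ t : (modLang S).Term β, ∀ (M : ModuleCat.{w} Sᵐᵒᵖ) (f : (β →₀ Sᵐᵒᵖ) →ₗ[Sᵐᵒᵖ] M),
      t.realize (fun i => f (Finsupp.single i 1)) = f τ := by
  induction τ using Finsupp.induction_linear with
  | zero => exact ⟨zero, fun M f => (map_zero f).symm⟩
  | add τ σ hτ hσ =>
    obtain ⟨t, ht⟩ := hτ
    obtain ⟨s, hs⟩ := hσ
    exact ⟨add t s, fun M f => by rw [realize_add, ht, hs, map_add]⟩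
  | single i a =>
    refine ⟨smul (Term.var i) a.unop, fun M f => ?_⟩
    rw [realize_smul, MulOpposite.op_unop, Term.realize_var, ← map_smul, Finsupp.smul_single,
      smul_eq_mul, _root_.mul_one]

variable {α : Type v} {n : ℕ} {𝒞 : Set (ModuleCat.{w} Sᵐᵒᵖ)}

/-- Satisfaction of a formula at the images of the free generators. -/
def RealizeAt (θ : (modLang S).BoundedFormula α n) (M : ModuleCat.{w} Sᵐᵒᵖ)
    (f : (α ⊕ Fin n →₀ Sᵐᵒᵖ) →ₗ[Sᵐᵒᵖ] M) : Prop :=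
  θ.Realize (fun i => f (Finsupp.single (Sum.inl i) 1)) fun i => f (Finsupp.single (Sum.inr i) 1)

theorem realizeAt_equal (t s : (modLang S).Term (α ⊕ Fin n)) (M : ModuleCat.{w} Sᵐᵒᵖ)
    (f : (α ⊕ Fin n →₀ Sᵐᵒᵖ) →ₗ[Sᵐᵒᵖ] M) :
    RealizeAt (BoundedFormula.equal t s) M f ↔
      t.realize (fun i => f (Finsupp.single i 1)) = s.realize fun i => f (Finsupp.single i 1) := by
  have : Sum.elim (fun i => f (Finsupp.single (Sum.inl i) 1))
      (fun i => f (Finsupp.single (Sum.inr i) 1)) = fun i => f (Finsupp.single i 1) := by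
    ext (i | i) <;> rfl
  rw [RealizeAt, BoundedFormula.Realize, this]

theorem realizeAt_all (θ : (modLang S).BoundedFormula α (n + 1)) :
    ∃ ρ : (α ⊕ Fin (n + 1) →₀ Sᵐᵒᵖ) →ₗ[Sᵐᵒᵖ] (α ⊕ Fin n →₀ Sᵐᵒᵖ) × Sᵐᵒᵖ,
      ∀ (M : ModuleCat.{w} Sᵐᵒᵖ) (f : (α ⊕ Fin n →₀ Sᵐᵒᵖ) →ₗ[Sᵐᵒᵖ] M),
        RealizeAt θ.all M f ↔
          ∀ x, RealizeAt θ M (f.coprod (LinearMap.toSpanSingleton Sᵐᵒᵖ M x) ∘ₗ ρ) := by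
  -- The newly bound variable becomes the generator `(0, 1)`, which the coproduct map sends to `x`;
  -- the others keep their values under `f`.
  let b : α ⊕ Fin (n + 1) → (α ⊕ Fin n →₀ Sᵐᵒᵖ) × Sᵐᵒᵖ :=
    Sum.elim (fun i => (Finsupp.single (Sum.inl i) 1, 0))
      (Fin.snoc (α := fun _ => (α ⊕ Fin n →₀ Sᵐᵒᵖ) × Sᵐᵒᵖ)
        (fun i => (Finsupp.single (Sum.inr i) 1, 0)) (0, 1))
  refine ⟨Finsupp.linearCombination Sᵐᵒᵖ b, fun M f => ?_⟩
  rw [RealizeAt, BoundedFormula.realize_all]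
  refine forall_congr' fun x => ?_
  rw [RealizeAt]
  have h₁ : ∀ i, (f.coprod (LinearMap.toSpanSingleton Sᵐᵒᵖ M x) ∘ₗ
      Finsupp.linearCombination Sᵐᵒᵖ b) (Finsupp.single i 1) =
        f (b i).1 + (b i).2 • x := fun i => by
    simp [Finsupp.linearCombination_single]
  simp only [h₁]
  refine iff_of_eq ?_
  congr 1
  · funext i
    simp [b]
  · funext i
    refine Fin.lastCases ?_ (fun i => ?_) i
    · simp [b]
    · simp [b]

/-- In a class of modules where existential quantification preserves finite determination,
satisfaction of every formula is finitely determined. -/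
theorem finitelyDetermined_realizeAt
    (hpres : ∀ (n : ℕ) (r : Sᵐᵒᵖ), r ≠ 0 → PreservesDetermined (α ⊕ Fin n →₀ Sᵐᵒᵖ) 𝒞 r)
    (hinf : ∀ M ∈ 𝒞, Infinite M)
    (hdiv : ∀ M ∈ 𝒞, ∀ r : Sᵐᵒᵖ, r ≠ 0 → ∀ x : M, ∃ y : M, r • y = x)
    (θ : (modLang S).BoundedFormula α n) : FinitelyDetermined 𝒞 (RealizeAt θ) := by
  induction θ with
  | falsum => exact finitelyDetermined_false
  | equal t s =>
    obtain ⟨τ, hτ⟩ := exists_linear_of_term.{u, v, w} t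
    obtain ⟨σ, hσ⟩ := exists_linear_of_term.{u, v, w} s
    refine ⟨{τ - σ}, fun M hM N hN f g hfg h => ?_⟩
    have := hfg _ (Finset.mem_singleton_self _)
    rw [map_sub, map_sub, sub_eq_zero, sub_eq_zero] at this
    rw [realizeAt_equal, hτ, hσ] at h ⊢
    exact this.1 h
  | rel R => exact R.elim
  | imp θ₁ θ₂ h₁ h₂ => exact h₁.imp h₂
  | all θ h =>
    obtain ⟨ρ, hρ⟩ := realizeAt_all.{u, v, w} θ
    -- The universal quantifier is treated as `¬ ∃ ¬`.
    have key := ((h.not.comp_coprod ρ).exists (hpres _) hinf hdiv).not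
    simp only [not_exists, not_not, ← hρ] at key
    exact key

/-- A finitely determined property is defined by a quantifier-free formula. -/
theorem exists_isQF_of_finitelyDetermined
    {P : ∀ M : ModuleCat.{w} Sᵐᵒᵖ, ((α ⊕ Fin n →₀ Sᵐᵒᵖ) →ₗ[Sᵐᵒᵖ] M) → Prop}
    (hP : FinitelyDetermined 𝒞 P) :
    ∃ ψ : (modLang S).BoundedFormula α n, ψ.IsQF ∧ ∀ M ∈ 𝒞, ∀ f, P M f ↔ RealizeAt ψ M f := by
  classical
  obtain ⟨G, hG⟩ := hP
  induction G using Finset.induction_on generalizing P with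
  | empty =>
    by_cases h : ∃ M ∈ 𝒞, ∃ f, P M f
    · obtain ⟨M, hM, f, hf⟩ := h
      exact ⟨⊤, BoundedFormula.IsQF.top, fun N hN g => iff_of_true
        (hG M hM N hN f g (by simp) hf) (BoundedFormula.realize_top.2 trivial)⟩
    · push Not at h
      exact ⟨⊥, BoundedFormula.isQF_bot, fun N hN g => iff_of_false (h N hN g) id⟩
  | insert τ G _ ih =>
    obtain ⟨t, ht⟩ := exists_term_of_linear.{u, v, w} τ
    -- `Q C` asks for a map satisfying `P` that agrees with `g` on `G` and has truth value `C` for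
    -- the equation at `τ`. It depends on `G` alone, so the induction hypothesis applies, and `P` is
    -- recovered by splitting on `g τ = 0`.
    let Q (C : Prop) (N : ModuleCat.{w} Sᵐᵒᵖ) (g : (α ⊕ Fin n →₀ Sᵐᵒᵖ) →ₗ[Sᵐᵒᵖ] N) : Prop :=
      ∃ M ∈ 𝒞, ∃ f : (α ⊕ Fin n →₀ Sᵐᵒᵖ) →ₗ[Sᵐᵒᵖ] M,
        (∀ σ ∈ G, f σ = 0 ↔ g σ = 0) ∧ (f τ = 0 ↔ C) ∧ P M f
    have hQ : ∀ C : Prop, ∃ ψ : (modLang S).BoundedFormula α n, ψ.IsQF ∧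
        ∀ M ∈ 𝒞, ∀ f, Q C M f ↔ RealizeAt ψ M f := fun C => by
      refine ih fun N hN N' hN' g g' hg ⟨M, hM, f, hf, hC, h⟩ => ?_
      exact ⟨M, hM, f, fun σ hσ => (hf σ hσ).trans (hg σ hσ), hC, h⟩
    obtain ⟨ψ₁, hψ₁, h₁⟩ := hQ True
    obtain ⟨ψ₂, hψ₂, h₂⟩ := hQ False
    have hatom : (BoundedFormula.equal t zero).IsQF :=
      (BoundedFormula.IsAtomic.equal t zero).isQF
    refine ⟨(BoundedFormula.equal t zero ⊓ ψ₁) ⊔ ((BoundedFormula.equal t zero).not ⊓ ψ₂),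
      (hatom.inf hψ₁).sup (hatom.not.inf hψ₂), fun N hN g => ?_⟩
    have hR : RealizeAt (BoundedFormula.equal t zero ⊓ ψ₁ ⊔
        (BoundedFormula.equal t zero).not ⊓ ψ₂) N g ↔
        (g τ = 0 ∧ Q True N g) ∨ (¬ g τ = 0 ∧ Q False N g) := by
      have := realizeAt_equal t zero N g
      rw [ht, realize_zero] at this
      rw [h₁ N hN, h₂ N hN, ← this]
      simp only [RealizeAt, BoundedFormula.realize_sup, BoundedFormula.realize_inf,
        BoundedFormula.realize_not]
    rw [hR]
    have hPQ : ∀ C : Prop, (g τ = 0 ↔ C) → Q C N g → P N g := by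
      rintro C hC ⟨M, hM, f, hf, hC', h⟩
      refine hG M hM N hN f g (fun σ hσ => ?_) h
      rcases Finset.mem_insert.1 hσ with rfl | hσ
      · rw [hC, hC']
      · exact hf σ hσ
    constructor
    · intro h
      by_cases h0 : g τ = 0
      · exact Or.inl ⟨h0, N, hN, g, fun _ _ => Iff.rfl, iff_true_intro h0, h⟩
      · exact Or.inr ⟨h0, N, hN, g, fun _ _ => Iff.rfl, iff_false_intro h0, h⟩
    · rintro (⟨h0, h⟩ | ⟨h0, h⟩)
      · exact hPQ True (iff_true_intro h0) h
      · exact hPQ False (iff_false_intro h0) h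

end modLang

/-! ### Divisible modules over `K[t;φ]` with prescribed root counts. -/

namespace TwistedPoly

universe w

variable {K : Type u} [Field K] {φ : K →+* K}

/-- The nonzero divisible right modules in which `ν q` elements are annihilated by each
irreducible `q`. -/
def divisibleModules (ν : {q : TwistedPoly φ // Irreducible q} → ℕ∞) :
    Set (ModuleCat.{w} (TwistedPoly φ)ᵐᵒᵖ) :=
  {M | (Nontrivial M ∧ ∀ r : TwistedPoly φ, r ≠ 0 → ∀ x : M, ∃ y : M, MulOpposite.op r • y = x) ∧
    ∀ q, ENat.card {x : M // MulOpposite.op q.1 • x = 0} = ν q}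

/-- On a finite `M`, two distinct scalars of the infinite ring would act identically; their
difference would annihilate `M`, against divisibility. -/
theorem infinite_of_divisible {S M : Type*} [Ring S] [Infinite S] [AddCommGroup M] [Module Sᵐᵒᵖ M]
    [Nontrivial M] (hdiv : ∀ r : S, r ≠ 0 → ∀ x : M, ∃ y : M, MulOpposite.op r • y = x) :
    Infinite M := by
  by_contra hM
  rw [not_infinite_iff_finite] at hM
  refine not_injective_infinite_finite (fun (r : S) (x : M) => MulOpposite.op r • x) ?_
  intro r s hrs
  by_contra hne
  obtain ⟨x, hx⟩ := exists_ne (0 : M)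
  obtain ⟨y, rfl⟩ := hdiv (r - s) (sub_ne_zero.2 hne) x
  rw [MulOpposite.op_sub, sub_smul] at hx
  exact hx (sub_eq_zero.2 (congrFun hrs y))

variable {ν : {q : TwistedPoly φ // Irreducible q} → ℕ∞}

theorem preservesDetermined_divisibleModules (F : Type v) [AddCommGroup F]
    [Module (TwistedPoly φ)ᵐᵒᵖ F] {r : TwistedPoly φ} (hr : r ≠ 0) :
    PreservesDetermined F (divisibleModules.{u, w} ν) (MulOpposite.op r) := by
  refine induction_on_factors
    (motive := fun r => PreservesDetermined F (divisibleModules.{u, w} ν) (MulOpposite.op r)) hr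
    (fun g hg => preservesDetermined_of_isUnit hg.op)
    (fun q hq => preservesDetermined_of_maximal (fun r => ?_)
      (fun M hM => hM.1.2 q hq.ne_zero)
      fun M hM N hN => (hM.2 ⟨q, hq⟩).trans (hN.2 ⟨q, hq⟩).symm)
    -- Passing to the opposite ring reverses the product.
    fun g h hg hh => by simpa using hh.mul hg
  rcases eq_mul_or_add_eq_one_of_irreducible hq r.unop with ⟨s, hs⟩ | ⟨u, v, h⟩
  · exact Or.inl ⟨MulOpposite.op s, by rw [← MulOpposite.op_mul, ← hs, MulOpposite.op_unop]⟩
  · exact Or.inr ⟨MulOpposite.op u, MulOpposite.op v, congrArg MulOpposite.op h⟩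

theorem finitelyDetermined_realizeAt_divisibleModules {α : Type v} {n : ℕ}
    (θ : (modLang (TwistedPoly φ)).BoundedFormula α n) :
    FinitelyDetermined (divisibleModules.{u, w} ν) (modLang.RealizeAt θ) :=
  modLang.finitelyDetermined_realizeAt
    (fun n r hr => preservesDetermined_divisibleModules _
      (r := r.unop) (mt (MulOpposite.unop_eq_zero_iff r).1 hr))
    (fun M hM => by
      have := hM.1.1
      exact infinite_of_divisible hM.1.2)
    (fun M hM r hr => hM.1.2 r.unop (mt (MulOpposite.unop_eq_zero_iff r).1 hr)) θ

variable (ν) in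
/-- The theory of nonzero divisible right modules in which `ν q` elements are annihilated by each
irreducible `q`. -/
abbrev divisibleRootTheory : (modLang (TwistedPoly φ)).Theory :=
  modLang.divisibleTheory (TwistedPoly φ) ∪ modLang.rootCountTheory (TwistedPoly φ) ν

theorem exists_module_of_model {M : Type w} [inst : (modLang (TwistedPoly φ)).Structure M]
    [hM : M ⊨ modLang.divisibleTheory (TwistedPoly φ)] :
    ∃ (_ : AddCommGroup M) (_ : Module (TwistedPoly φ)ᵐᵒᵖ M),
      inst = modLang.instStructureOfModuleMulOpposite M :=
  modLang.exists_module_of_axioms fun _ hσ => hM.realize_of_mem _ (Or.inl (Or.inl hσ))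

theorem mem_divisibleModules {M : Type w} [AddCommGroup M] [Module (TwistedPoly φ)ᵐᵒᵖ M]
    (hM : M ⊨ divisibleRootTheory ν) : ModuleCat.of _ M ∈ divisibleModules ν := by
  rw [Theory.model_union_iff, modLang.model_divisibleTheory_iff,
    modLang.model_rootCountTheory_iff] at hM
  exact hM

/-- Every assignment of the variables extends to a linear map on the free module, so statements
about maps cover all assignments. -/
theorem realizeAt_linearCombination {M : Type w} [AddCommGroup M]
    [Module (TwistedPoly φ)ᵐᵒᵖ M] {α : Type v} {n : ℕ}
    (θ : (modLang (TwistedPoly φ)).BoundedFormula α n) (v : α → M) (xs : Fin n → M) :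
    modLang.RealizeAt θ (ModuleCat.of _ M)
      (Finsupp.linearCombination (TwistedPoly φ)ᵐᵒᵖ (Sum.elim v xs)) ↔ θ.Realize v xs := by
  simp [modLang.RealizeAt]

/-- Modulo `divisibleRootTheory ν`, every formula is equivalent to a quantifier-free formula. -/
theorem exists_isQF_realize_iff {α : Type v} (ν : {q : TwistedPoly φ // Irreducible q} → ℕ∞)
    (θ : (modLang (TwistedPoly φ)).Formula α) :
    ∃ ψ : (modLang (TwistedPoly φ)).Formula α, BoundedFormula.IsQF ψ ∧
      ∀ (M : Type w) [(modLang (TwistedPoly φ)).Structure M] [M ⊨ divisibleRootTheory ν]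
        (v : α → M), θ.Realize v ↔ ψ.Realize v := by
  obtain ⟨ψ, hψ, h⟩ := modLang.exists_isQF_of_finitelyDetermined
    (finitelyDetermined_realizeAt_divisibleModules.{u, v, w} (ν := ν) θ)
  refine ⟨ψ, hψ, fun M inst hM v => ?_⟩
  have := (Theory.model_union_iff.1 hM).1
  obtain ⟨_, _, rfl⟩ := exists_module_of_model (φ := φ) (M := M)
  have := h _ (mem_divisibleModules hM)
    (Finsupp.linearCombination (TwistedPoly φ)ᵐᵒᵖ (Sum.elim v default))
  rwa [realizeAt_linearCombination, realizeAt_linearCombination] at this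

/-- Models of `divisibleRootTheory ν` satisfy the same sentences. -/
theorem realize_sentence_of_realize (σ : (modLang (TwistedPoly φ)).Sentence) (M N : Type w)
    [(modLang (TwistedPoly φ)).Structure M] [(modLang (TwistedPoly φ)).Structure N]
    [hM : M ⊨ divisibleRootTheory ν] [hN : N ⊨ divisibleRootTheory ν] (h : M ⊨ σ) : N ⊨ σ := by
  have := (Theory.model_union_iff.1 hM).1
  have := (Theory.model_union_iff.1 hN).1
  obtain ⟨_, _, rfl⟩ := exists_module_of_model (φ := φ) (M := M)
  obtain ⟨_, _, rfl⟩ := exists_module_of_model (φ := φ) (M := N)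
  obtain ⟨G, hG⟩ := finitelyDetermined_realizeAt_divisibleModules.{u, 0, w} (ν := ν) σ
  -- A sentence has no variables, so the free module is zero and the finitely many conditions hold
  -- trivially on both sides.
  exact (realizeAt_linearCombination σ _ _).1 (hG _ (mem_divisibleModules hM) _
    (mem_divisibleModules hN) _ _ (fun τ _ => by simp [Subsingleton.elim τ 0])
    ((realizeAt_linearCombination σ _ _).2 h))

theorem isComplete_divisibleRootTheory (h : (divisibleRootTheory ν).IsSatisfiable) :
    (divisibleRootTheory ν).IsComplete := by
  refine ⟨h, fun σ => ?_⟩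
  obtain ⟨M⟩ := h
  by_cases hσ : M ⊨ σ
  · exact Or.inl (Theory.models_sentence_iff.2 fun N =>
      realize_sentence_of_realize (ν := ν) σ M N hσ)
  · exact Or.inr (Theory.models_sentence_iff.2 fun N =>
      realize_sentence_of_realize (ν := ν) σ.not M N ((Sentence.realize_not M).2 hσ))

/-- A model of `divisibleTheory` is a model of `rootCountTheory ν` for some `ν`. -/
theorem exists_model_rootCountTheory (M : Type w) [(modLang (TwistedPoly φ)).Structure M]
    [hM : M ⊨ modLang.divisibleTheory (TwistedPoly φ)] :
    ∃ ν, M ⊨ modLang.rootCountTheory (TwistedPoly φ) ν := by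
  obtain ⟨_, _, rfl⟩ := exists_module_of_model (φ := φ) (M := M)
  exact ⟨_, (modLang.model_rootCountTheory_iff _).2 fun _ => rfl⟩

theorem eq_of_model_rootCountTheory {ν ν' : {q : TwistedPoly φ // Irreducible q} → ℕ∞}
    (M : Type w) [(modLang (TwistedPoly φ)).Structure M] [hM : M ⊨ divisibleRootTheory ν]
    [hM' : M ⊨ divisibleRootTheory ν'] : ν = ν' := by
  rw [Theory.model_union_iff] at hM hM'
  have := hM.1
  obtain ⟨_, _, rfl⟩ := exists_module_of_model (φ := φ) (M := M)
  exact funext fun q => ((modLang.model_rootCountTheory_iff ν).1 hM.2 q).symm.trans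
    ((modLang.model_rootCountTheory_iff ν').1 hM'.2 q)

end TwistedPoly

theorem theorem1p1 {K : Type u} [Field K] (φ : K →+* K) :
    (∀ T : (modLang (TwistedPoly φ)).Theory, T.IsComplete →
      (∀ σ ∈ modLang.divisibleTheory (TwistedPoly φ), T ⊨ᵇ σ) →
        HasQE T ∧
        ∃! ν : {q : TwistedPoly φ // Irreducible q} → ℕ∞,
          ∀ σ : (modLang (TwistedPoly φ)).Sentence,
            T ⊨ᵇ σ ↔ (modLang.divisibleTheory (TwistedPoly φ) ∪
              modLang.rootCountTheory (TwistedPoly φ) ν) ⊨ᵇ σ) ∧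
    (∀ ν : {q : TwistedPoly φ // Irreducible q} → ℕ∞,
      (modLang.divisibleTheory (TwistedPoly φ) ∪
        modLang.rootCountTheory (TwistedPoly φ) ν).IsSatisfiable →
      (modLang.divisibleTheory (TwistedPoly φ) ∪
        modLang.rootCountTheory (TwistedPoly φ) ν).IsComplete) := by
  refine ⟨fun T hT hdiv => ?_, fun ν => TwistedPoly.isComplete_divisibleRootTheory⟩
  obtain ⟨M⟩ := hT.1
  have hMd : M ⊨ modLang.divisibleTheory (TwistedPoly φ) :=
    ⟨fun σ hσ => (hdiv σ hσ).realize_sentence M⟩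
  obtain ⟨ν, hMν⟩ := TwistedPoly.exists_model_rootCountTheory (φ := φ) M
  have hMdν : M ⊨ TwistedPoly.divisibleRootTheory ν := Theory.model_union_iff.2 ⟨hMd, hMν⟩
  have hcomplete : (TwistedPoly.divisibleRootTheory ν).IsComplete :=
    TwistedPoly.isComplete_divisibleRootTheory (Theory.Model.isSatisfiable M)
  -- Both theories are complete and `M` is a model of both, so each proves exactly what holds in
  -- `M`.
  have hiff : ∀ σ, T ⊨ᵇ σ ↔ TwistedPoly.divisibleRootTheory ν ⊨ᵇ σ := fun σ => by
    rw [← hT.realize_sentence_iff σ M, ← hcomplete.realize_sentence_iff σ M]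
  have hmodel : ∀ ν', (∀ σ, T ⊨ᵇ σ ↔ TwistedPoly.divisibleRootTheory ν' ⊨ᵇ σ) →
      ∀ N : T.ModelType, N ⊨ TwistedPoly.divisibleRootTheory ν' := fun ν' h N =>
    ⟨fun σ hσ => ((h σ).2 (Theory.models_sentence_of_mem hσ)).realize_sentence N⟩
  refine ⟨fun n θ => ?_, ν, hiff, fun ν' hν' => ?_⟩
  · obtain ⟨ψ, hψ, h⟩ := TwistedPoly.exists_isQF_realize_iff.{u, 0, u} ν θ
    refine ⟨ψ, hψ, Theory.models_formula_iff.2 fun N v => ?_⟩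
    have := hmodel ν hiff N
    exact Formula.realize_iff.2 (h N v)
  -- Uniqueness: `M` is also a model for `ν'`, and its root counts determine the function.
  · have := hmodel ν' hν' M
    exact TwistedPoly.eq_of_model_rootCountTheory M
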